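/- Notation. Vectors of $\mathbb{R}^n$ carry the Euclidean norm and inner product, $\odot$ and powers are entrywise, and $\mathcal{P}_+(v)=\max\{v,0\}$ entrywise. An absolutely continuous curve is a continuous curve that is differentiable almost everywhere and equals its initial value plus the Lebesgue integral of its derivative. A set-valued mapping $\mathcal{D}:\mathbb{R}^n\rightrightarrows\mathbb{R}^n$ with closed graph and nonempty compact values is a conservative field if $t\mapsto\max_{d\in \mathcal{D}(\gamma(t))}\langle\gamma'(t),d\rangle$ is integrable with $\int_0^1\max_{d\in \mathcal{D}(\gamma(t))}\langle\gamma'(t),d\rangle\,dt=0$ for every absolutely continuous $\gamma:[0,1]\to\mathbb{R}^n$ with $\gamma(0)=\gamma(1)$. It is a conservative field for $f:\mathbb{R}^n\to\mathbb{R}$ if moreover $$f(\gamma(1))=f(\gamma(0))+\int_0^1\max_{d\in \mathcal{D}(\gamma(t))}\langle\gamma'(t),d\rangle\,dt=f(\gamma(0))+\int_0^1\min_{d\in \mathcal{D}(\gamma(t))}\langle\gamma'(t),d\rangle\,dt$$ for every absolutely continuous $\gamma:[0,1]\to\mathbb{R}^n$ (both integrands being integrable). Let $F:\mathbb{R}^N\rightrightarrows\mathbb{R}^N$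 be locally bounded with closed graph and nonempty compact convex values. A solution of $\dot z\in F(z)$ is an absolutely continuous curve $\gamma:[0,\infty)\to\mathbb{R}^N$ with $\dot\gamma(t)\in F(\gamma(t))$ for almost every $t\ge 0$. A continuous function $\phi:\mathbb{R}^N\to\mathbb{R}$ is a Lyapunov function for $\dot z\in F(z)$ with stable set $\mathcal{B}$, where $\mathcal{B}\subset\mathbb{R}^N$ is closed, if every solution $\gamma$ with $\gamma(0)\in\mathcal{B}$ satisfies $\phi(\gamma(t))\le\phi(\gamma(0))$ for all $t\ge 0$, and every solution $\gamma$ with $\gamma(0)\notin\mathcal{B}$ satisfies $\phi(\gamma(t))<\phi(\gamma(0))$ for all $t>0$. Proposition. Let $f:\mathbb{R}^n\to\mathbb{R}$ be locally Lipschitz, and let $\mathcal{D}_f$ be a convex-valued conservative field for $f$. Let $\sigma,\varepsilon,\tau_2,M_W>0$ and $\tau_1\ge\tau_2/4$. Put $\mathcal{D}_g(x)=\mathcal{D}_f(x)+\sigma x$, $\mathcal{U}=\{d\in\mathbb{R}^n: d_i\ge 0 \text{ for all } i,\ \|d\|\le M_W\}$ and $$\mathcal{G}(x,m,v)=\begin{bmatrix}(\mathcal{P}_+(v)+\varepsilon)^{-1/2}\odot(m+\sigma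 x)\\ \tau_1 m-\tau_1\mathcal{D}_f(x)\\ \tau_2 v-\tau_2\,\mathcal{U}\end{bmatrix}.$$ Then $-\mathcal{G}$ is locally bounded with closed graph and nonempty compact convex values, and the function $$h(x,m,v)=f(x)+\frac{\sigma}{2}\|x\|^2+\frac{1}{2\tau_1}\left\langle m+\sigma x,(\mathcal{P}_+(v)+\varepsilon)^{-1/2}\odot(m+\sigma x)\right\rangle$$ on $\mathbb{R}^n\times\mathbb{R}^n\times\mathbb{R}^n$ is a Lyapunov function for the differential inclusion $(\dot x,\dot m,\dot v)\in-\mathcal{G}(x,m,v)$ with the stable set $\{(x,m,v): 0\in\mathcal{D}_g(x),\ m+\sigma x=0\}$; in particular $h$ is continuous and this set is closed. -/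

import Mathlib

open MeasureTheory Set Filter Topology

noncomputable section

namespace AdamLyapunov

/-- `γ` restricted to the interval `I` (with left end point `0`) is an absolutely continuous curve:
it is continuous, differentiable almost everywhere, and the Lebesgue integral of its derivative. -/
structure IsAbsContCurve {X : Type*} [NormedAddCommGroup X] [NormedSpace ℝ X]
    (I : Set ℝ) (γ : ℝ → X) : Prop where
  continuousOn : ContinuousOn γ I
  ae_differentiableAt : ∀ᵐ t ∂(volume.restrict I), DifferentiableAt ℝ γ t
  intervalIntegrable_deriv : ∀ t ∈ I, IntervalIntegrable (deriv γ) volume 0 t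
  eq_integral : ∀ t ∈ I, γ t = γ 0 + ∫ u in (0 : ℝ)..t, deriv γ u

/-- The set-valued mapping `D` has a closed graph. -/
def HasClosedGraph {X Y : Type*} [TopologicalSpace X] [TopologicalSpace Y]
    (D : X → Set Y) : Prop :=
  IsClosed {p : X × Y | p.2 ∈ D p.1}

/-- The set-valued mapping `D` is locally bounded. -/
def IsLocallyBounded {X Y : Type*} [TopologicalSpace X] [Bornology Y]
    (D : X → Set Y) : Prop :=
  ∀ x, ∃ V ∈ 𝓝 x, Bornology.IsBounded (⋃ y ∈ V, D y)

section Conservative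

variable {E : Type*} [NormedAddCommGroup E] [InnerProductSpace ℝ E]

/-- `t ↦ max_{d ∈ D (γ t)} ⟪γ' t, d⟫`; the supremum is attained when `D` has nonempty compact
values. -/
def maxRate (D : E → Set E) (γ : ℝ → E) (t : ℝ) : ℝ :=
  sSup ((fun d => inner ℝ (deriv γ t) d) '' D (γ t))

/-- `t ↦ min_{d ∈ D (γ t)} ⟪γ' t, d⟫`; the infimum is attained when `D` has nonempty compact
values. -/
def minRate (D : E → Set E) (γ : ℝ → E) (t : ℝ) : ℝ :=
  sInf ((fun d => inner ℝ (deriv γ t) d) '' D (γ t))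

/-- `D` is a conservative field: closed graph, nonempty compact values, and vanishing
(Lebesgue) circulation along every absolutely continuous loop. -/
structure IsConservativeField (D : E → Set E) : Prop where
  closedGraph : HasClosedGraph D
  nonempty : ∀ x, (D x).Nonempty
  isCompact : ∀ x, IsCompact (D x)
  loop : ∀ γ : ℝ → E, IsAbsContCurve (Icc 0 1) γ → γ 0 = γ 1 →
    IntervalIntegrable (maxRate D γ) volume 0 1 ∧ ∫ t in (0 : ℝ)..1, maxRate D γ t = 0

/-- `f` is a potential function of the set-valued mapping `D`: along every absolutely continuous
curve the increment of `f` is the path integral of `D`, computed with the maximum or with the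
minimum. -/
structure IsPotential (D : E → Set E) (f : E → ℝ) : Prop where
  max_integral : ∀ γ : ℝ → E, IsAbsContCurve (Icc 0 1) γ →
    IntervalIntegrable (maxRate D γ) volume 0 1 ∧
      f (γ 1) = f (γ 0) + ∫ t in (0 : ℝ)..1, maxRate D γ t
  min_integral : ∀ γ : ℝ → E, IsAbsContCurve (Icc 0 1) γ →
    IntervalIntegrable (minRate D γ) volume 0 1 ∧
      f (γ 1) = f (γ 0) + ∫ t in (0 : ℝ)..1, minRate D γ t

/-- `f` is path-differentiable and admits `D` as its conservative field. -/
structure IsPathDifferentiableWith (f : E → ℝ) (D : E → Set E) : Prop where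
  locallyLipschitz : LocallyLipschitz f
  conservative : IsConservativeField D
  potential : IsPotential D f

end Conservative

section Inclusion

variable {X : Type*} [NormedAddCommGroup X] [NormedSpace ℝ X]

/-- The right-hand sides for which the differential inclusion `γ' ∈ F γ` is considered. -/
structure IsAdmissibleField (F : X → Set X) : Prop where
  locallyBounded : IsLocallyBounded F
  nonempty : ∀ z, (F z).Nonempty
  isCompact : ∀ z, IsCompact (F z)
  convex : ∀ z, Convex ℝ (F z)
  closedGraph : HasClosedGraph F

/-- `γ`, restricted to `[0, ∞)`, is a solution of the differential inclusion `γ' ∈ F γ`. -/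
structure IsSolution (F : X → Set X) (γ : ℝ → X) : Prop where
  absCont : IsAbsContCurve (Ici 0) γ
  ae_mem : ∀ᵐ t ∂(volume.restrict (Ici (0 : ℝ))), deriv γ t ∈ F (γ t)

/-- `φ` is a Lyapunov function, with stable set `B`, for the differential inclusion `γ' ∈ F γ`. -/
structure IsLyapunovFunction (F : X → Set X) (φ : X → ℝ) (B : Set X) : Prop where
  admissible : IsAdmissibleField F
  isClosed : IsClosed B
  continuous : Continuous φ
  le_of_mem : ∀ γ : ℝ → X, IsSolution F γ → γ 0 ∈ B → ∀ t, 0 ≤ t → φ (γ t) ≤ φ (γ 0)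
  lt_of_notMem : ∀ γ : ℝ → X, IsSolution F γ → γ 0 ∉ B → ∀ t, 0 < t → φ (γ t) < φ (γ 0)

end Inclusion

section Adam

variable {n : ℕ}

/-- The entrywise expression `(max(v, 0) + ε)^{-1/2} ⊙ w`. -/
def precond (ε : ℝ) (v w : EuclideanSpace ℝ (Fin n)) : EuclideanSpace ℝ (Fin n) :=
  WithLp.toLp 2 fun i => (max (v i) 0 + ε) ^ (-(1 / 2) : ℝ) * w i

/-- `U = {d ∈ ℝⁿ₊ : ‖d‖ ≤ M}`. -/
def estimatorSet (n : ℕ) (M : ℝ) : Set (EuclideanSpace ℝ (Fin n)) :=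
  {d | (∀ i, 0 ≤ d i) ∧ ‖d‖ ≤ M}

/-- The set-valued mapping `G(x, m, v)`. -/
def adamField (D : EuclideanSpace ℝ (Fin n) → Set (EuclideanSpace ℝ (Fin n)))
    (σ ε τ₁ τ₂ M : ℝ)
    (z : EuclideanSpace ℝ (Fin n) × EuclideanSpace ℝ (Fin n) × EuclideanSpace ℝ (Fin n)) :
    Set (EuclideanSpace ℝ (Fin n) × EuclideanSpace ℝ (Fin n) × EuclideanSpace ℝ (Fin n)) :=
  {w | w.1 = precond ε z.2.2 (z.2.1 + σ • z.1) ∧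
    (∃ d ∈ D z.1, w.2.1 = τ₁ • z.2.1 - τ₁ • d) ∧
    (∃ u ∈ estimatorSet n M, w.2.2 = τ₂ • z.2.2 - τ₂ • u)}

/-- The conservative field `D_g(x) = D_f(x) + σ x` of `g = f + (σ/2) ‖·‖²`. -/
def regField (D : EuclideanSpace ℝ (Fin n) → Set (EuclideanSpace ℝ (Fin n))) (σ : ℝ)
    (x : EuclideanSpace ℝ (Fin n)) : Set (EuclideanSpace ℝ (Fin n)) :=
  (fun d => d + σ • x) '' D x

/-- The function `h(x, m, v)`. -/
def adamLyapunov (f : EuclideanSpace ℝ (Fin n) → ℝ) (σ ε τ₁ : ℝ)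
    (z : EuclideanSpace ℝ (Fin n) × EuclideanSpace ℝ (Fin n) × EuclideanSpace ℝ (Fin n)) : ℝ :=
  f z.1 + σ / 2 * ‖z.1‖ ^ 2 +
    1 / (2 * τ₁) * inner ℝ (z.2.1 + σ • z.1) (precond ε z.2.2 (z.2.1 + σ • z.1))

end Adam

end AdamLyapunov

end

/-!
The function `h` splits as `f (x)` plus a sum over coordinates of
`coordEnergy = (σ / 2) x² + w y² / (2 τ₁)`, where `y = m + σ x` and `w = (max v 0 + ε)^(-1/2)`.

*Dissipation.* A solution satisfies `x' = -w y` and selects elements `d = m + m' / τ₁` of `D x` and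
`u = v + v' / τ₂` of `U`. The derivative of `coordEnergy` is
`-d x' - (σ / τ₁) x'² - w y² + w' y² / (2 τ₁)`. Since `u ≥ 0`, `v' ≥ -τ₂ v`, so `w` grows at relative
rate at most `τ₂ / 2` (`deriv_rpow_max_add_le`; where `v ≤ 0` it is at its maximum), and
`τ₂ ≤ 4 τ₁` lets `w y²` absorb the last term (`deriv_coordEnergy_le`). The increment of `f` along `x`
is the path integral of `min ⟪x', D x⟫ ≤ ⟪x', d⟫`, which cancels against `-d x'`. Integrating, which
is legitimate because all the terms are absolutely continuous, `h` decreases at least by the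
integral of `(σ / τ₁) ‖x'‖²` (`IsSolution.adamLyapunov_sub_le`). If there is no strict decrease on
`[0, T]`, then `y` vanishes there, `x` and `m` stand still, and `m' = 0` says that `m = -σ x` lies in
`D x`: the curve started in the stable set (`IsSolution.zero_mem_regField`).

*Admissibility.* Everything is immediate except local boundedness, which is not part of the
definition of a conservative field and uses the Lipschitz continuity of `f` together with the
convexity of the values (`IsPathDifferentiableWith.isLocallyBounded`). Along every line, almost every
point has the property that all elements of `D` have the same component along the line, namely the
directional derivative of `f`, which is bounded by the Lipschitz constant. Fubini over the coordinate
directions bounds `D` at almost every point, and the closed graph then yields a bounded element of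
`D y` at every nearby point `y`. A sequence of values escaping to infinity would, by convexity,
contain points on each large sphere, and their limits would make `D x` unbounded.
-/

namespace AdamLyapunov

/-! ### Absolutely continuous curves -/

section Curves

variable {X Y : Type*} [NormedAddCommGroup X] [NormedSpace ℝ X]
  [NormedAddCommGroup Y] [NormedSpace ℝ Y]

lemma uIoc_subset_Ici {T : ℝ} (hT : 0 ≤ T) : uIoc 0 T ⊆ Ici (0 : ℝ) := by
  rw [uIoc_of_le hT]
  exact fun t ht => ht.1.le

/-- On an interval `[0, T]`, an almost everywhere property on `[0, ∞)` holds almost everywhere. -/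
lemma ae_uIoc_of_ae_Ici {p : ℝ → Prop} (h : ∀ᵐ t ∂(volume.restrict (Ici (0 : ℝ))), p t)
    {T : ℝ} (hT : 0 ≤ T) : ∀ᵐ t, t ∈ uIoc 0 T → p t := by
  rw [ae_restrict_iff' measurableSet_Ici] at h
  filter_upwards [h] with t ht hm using ht (uIoc_subset_Ici hT hm)

lemma IsAbsContCurve.ae_deriv_clm_comp {γ : ℝ → X} (h : IsAbsContCurve (Ici 0) γ) (L : X →L[ℝ] Y) :
    ∀ᵐ t ∂(volume.restrict (Ici (0 : ℝ))), deriv (fun s => L (γ s)) t = L (deriv γ t) := by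
  filter_upwards [h.ae_differentiableAt] with t ht
  exact (L.hasFDerivAt.comp_hasDerivAt t ht.hasDerivAt).deriv

lemma IsAbsContCurve.clm_comp [CompleteSpace X] [CompleteSpace Y] {γ : ℝ → X}
    (h : IsAbsContCurve (Ici 0) γ) (L : X →L[ℝ] Y) :
    IsAbsContCurve (Ici 0) (fun s => L (γ s)) where
  continuousOn := L.continuous.comp_continuousOn h.continuousOn
  ae_differentiableAt := by
    filter_upwards [h.ae_differentiableAt] with t ht
    exact (L.hasFDerivAt.comp_hasDerivAt t ht.hasDerivAt).differentiableAt
  intervalIntegrable_deriv t ht := by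
    have h1 : IntervalIntegrable (fun s => L (deriv γ s)) volume 0 t := by
      have := h.intervalIntegrable_deriv t ht
      exact ⟨L.integrable_comp this.1, L.integrable_comp this.2⟩
    refine h1.congr_ae ?_
    rw [EventuallyEq, ae_restrict_iff' measurableSet_uIoc]
    filter_upwards [ae_uIoc_of_ae_Ici (h.ae_deriv_clm_comp L) ht] with s hs hm using (hs hm).symm
  eq_integral t ht := by
    rw [intervalIntegral.integral_congr_ae (ae_uIoc_of_ae_Ici (h.ae_deriv_clm_comp L) ht),
      L.intervalIntegral_comp_comm (h.intervalIntegrable_deriv t ht), ← map_add,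
      ← h.eq_integral t ht]

/-- A scalar curve that is the integral of its derivative is absolutely continuous in the
`ε`-`δ` sense on each `[0, T]`. -/
lemma IsAbsContCurve.absolutelyContinuousOnInterval {γ : ℝ → ℝ} (h : IsAbsContCurve (Ici 0) γ)
    {T : ℝ} (hT : 0 ≤ T) : AbsolutelyContinuousOnInterval γ 0 T := by
  have h1 := (h.intervalIntegrable_deriv T hT).absolutelyContinuousOnInterval_intervalIntegral
    (c := 0) (by simp)
  rw [absolutelyContinuousOnInterval_iff] at h1 ⊢
  intro ε hε
  obtain ⟨δ, hδ, H⟩ := h1 ε hε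
  refine ⟨δ, hδ, fun E hE hs => ?_⟩
  have hmem : ∀ t ∈ uIcc 0 T, γ t = γ 0 + ∫ u in (0 : ℝ)..t, deriv γ u := fun t ht =>
    h.eq_integral t (by rw [uIcc_of_le hT] at ht; exact ht.1)
  refine lt_of_eq_of_lt (Finset.sum_congr rfl fun i hi => ?_) (H E hE hs)
  rw [hmem _ (hE.1 i hi).1, hmem _ (hE.1 i hi).2, dist_add_left]

lemma _root_.LipschitzWith.comp_absolutelyContinuousOnInterval {K : NNReal} {φ : ℝ → ℝ}
    (hφ : LipschitzWith K φ) {γ : ℝ → ℝ} {a b : ℝ} (h : AbsolutelyContinuousOnInterval γ a b) :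
    AbsolutelyContinuousOnInterval (fun t => φ (γ t)) a b := by
  refine squeeze_zero (fun E => Finset.sum_nonneg fun i _ => dist_nonneg) (fun E => ?_)
    (by simpa using Tendsto.const_mul (K : ℝ) h)
  rw [Finset.mul_sum]
  exact Finset.sum_le_sum fun i _ => hφ.dist_le_mul _ _

/-- Restricting a curve to `[0, T]` and rescaling time gives a curve on `[0, 1]`. -/
lemma IsAbsContCurve.rescale {γ : ℝ → X} (h : IsAbsContCurve (Ici 0) γ)
    {T : ℝ} (hT : 0 < T) : IsAbsContCurve (Icc 0 1) (fun s => γ (T * s)) where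
  continuousOn := h.continuousOn.comp (by fun_prop) fun s hs => mul_nonneg hT.le hs.1
  ae_differentiableAt := by
    have h1 := h.ae_differentiableAt
    rw [ae_restrict_iff' measurableSet_Ici] at h1
    rw [ae_restrict_iff' measurableSet_Icc]
    have hq : Measure.QuasiMeasurePreserving (fun s : ℝ => T * s) volume volume := by
      refine ⟨measurable_const_mul T, ?_⟩
      rw [Real.map_volume_mul_left hT.ne']
      exact Measure.smul_absolutelyContinuous
    have h2 := hq.ae h1
    filter_upwards [h2] with s hs hm
    have h3 : DifferentiableAt ℝ γ (T * s) := hs (mul_nonneg hT.le hm.1)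
    exact h3.comp s (by fun_prop)
  intervalIntegrable_deriv t ht := by
    have h1 := (h.intervalIntegrable_deriv (T * t) (mul_nonneg hT.le ht.1)).comp_mul_left (c := T)
    rw [zero_div, mul_div_cancel_left₀ _ hT.ne'] at h1
    exact (h1.smul T).congr fun s _ => (deriv_comp_mul_left T γ s).symm
  eq_integral t ht := by
    simp_rw [deriv_comp_mul_left]
    rw [intervalIntegral.integral_smul, intervalIntegral.smul_integral_comp_mul_left, mul_zero]
    exact h.eq_integral _ (mul_nonneg hT.le ht.1)

end Curves

/-! ### Conservative fields along curves -/

section Conservative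

variable {E : Type*} [NormedAddCommGroup E] [InnerProductSpace ℝ E]

open Pointwise in
lemma maxRate_comp_mul_left (D : E → Set E) (γ : ℝ → E) {T : ℝ} (hT : 0 ≤ T) (s : ℝ) :
    maxRate D (fun s => γ (T * s)) s = T * maxRate D γ (T * s) := by
  rw [maxRate, maxRate, ← smul_eq_mul (a := T) (b := sSup _), ← Real.sSup_smul_of_nonneg hT,
    ← image_smul, image_image, deriv_comp_mul_left]
  simp only [real_inner_smul_left, smul_eq_mul]

open Pointwise in
lemma minRate_comp_mul_left (D : E → Set E) (γ : ℝ → E) {T : ℝ} (hT : 0 ≤ T) (s : ℝ) :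
    minRate D (fun s => γ (T * s)) s = T * minRate D γ (T * s) := by
  rw [minRate, minRate, ← smul_eq_mul (a := T) (b := sInf _), ← Real.sInf_smul_of_nonneg hT,
    ← image_smul, image_image, deriv_comp_mul_left]
  simp only [real_inner_smul_left, smul_eq_mul]

/-- Undoing the rescaling of `[0, T]` to `[0, 1]` in a path integral. -/
lemma intervalIntegrable_and_integral_eq_of_rescale {r : ℝ → ℝ} {T c : ℝ} (hT : 0 < T)
    (hi : IntervalIntegrable (fun s => T * r (T * s)) volume 0 1)
    (hc : ∫ s in (0 : ℝ)..1, T * r (T * s) = c) :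
    IntervalIntegrable r volume 0 T ∧ ∫ t in (0 : ℝ)..T, r t = c := by
  constructor
  · have h1 := hi.const_mul T⁻¹
    simp_rw [inv_mul_cancel_left₀ hT.ne'] at h1
    have h2 := IntervalIntegrable.comp_mul_left_iff (f := r) (a := 0) (b := T) hT.ne'
    rw [zero_div, div_self hT.ne'] at h2
    exact h2.1 h1
  · rw [intervalIntegral.integral_const_mul, intervalIntegral.mul_integral_comp_mul_left,
      mul_zero, mul_one] at hc
    exact hc

lemma IsPotential.integral_maxRate {D : E → Set E} {f : E → ℝ} (hf : IsPotential D f)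
    {γ : ℝ → E} (h : IsAbsContCurve (Ici 0) γ) {T : ℝ} (hT : 0 < T) :
    IntervalIntegrable (maxRate D γ) volume 0 T ∧
      ∫ t in (0 : ℝ)..T, maxRate D γ t = f (γ T) - f (γ 0) := by
  obtain ⟨hi, he⟩ := hf.max_integral _ (h.rescale hT)
  have hr : maxRate D (fun s => γ (T * s)) = fun s => T * maxRate D γ (T * s) :=
    funext (maxRate_comp_mul_left D γ hT.le)
  rw [hr] at hi he
  rw [mul_zero, mul_one] at he
  exact intervalIntegrable_and_integral_eq_of_rescale hT hi (by linarith)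

lemma IsPotential.integral_minRate {D : E → Set E} {f : E → ℝ} (hf : IsPotential D f)
    {γ : ℝ → E} (h : IsAbsContCurve (Ici 0) γ) {T : ℝ} (hT : 0 < T) :
    IntervalIntegrable (minRate D γ) volume 0 T ∧
      ∫ t in (0 : ℝ)..T, minRate D γ t = f (γ T) - f (γ 0) := by
  obtain ⟨hi, he⟩ := hf.min_integral _ (h.rescale hT)
  have hr : minRate D (fun s => γ (T * s)) = fun s => T * minRate D γ (T * s) :=
    funext (minRate_comp_mul_left D γ hT.le)
  rw [hr] at hi he
  rw [mul_zero, mul_one] at he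
  exact intervalIntegrable_and_integral_eq_of_rescale hT hi (by linarith)

lemma inner_le_maxRate {D : E → Set E} {γ : ℝ → E} {t : ℝ} (hc : IsCompact (D (γ t))) {d : E}
    (hd : d ∈ D (γ t)) : inner ℝ (deriv γ t) d ≤ maxRate D γ t :=
  le_csSup (hc.image (by fun_prop)).bddAbove (mem_image_of_mem _ hd)

lemma minRate_le_inner {D : E → Set E} {γ : ℝ → E} {t : ℝ} (hc : IsCompact (D (γ t))) {d : E}
    (hd : d ∈ D (γ t)) : minRate D γ t ≤ inner ℝ (deriv γ t) d :=
  csInf_le (hc.image (by fun_prop)).bddBelow (mem_image_of_mem _ hd)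

end Conservative

/-! ### Local boundedness of convex-valued conservative fields -/

section LocallyBounded

/-- Lebesgue differentiation for a function on `[0, ∞)` that is the integral of `r`. -/
lemma ae_hasDerivAt_of_integral_eq {F r : ℝ → ℝ}
    (h : ∀ T, 0 < T → IntervalIntegrable r volume 0 T ∧ ∫ t in (0 : ℝ)..T, r t = F T - F 0) :
    ∀ᵐ t, 0 < t → HasDerivAt F (r t) t := by
  have h1 : ∀ N : ℕ, ∀ᵐ t, t ∈ uIcc (0 : ℝ) (N + 1) → ∀ c ∈ uIcc (0 : ℝ) (N + 1),
      HasDerivAt (fun x => ∫ s in c..x, r s) (r t) t := fun N =>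
    (h (N + 1) (by positivity)).1.ae_hasDerivAt_integral
  filter_upwards [ae_all_iff.2 h1] with t ht h0
  obtain ⟨N, hN⟩ := exists_nat_gt t
  have h2 := (ht N (by rw [uIcc_of_le (by positivity)]; exact ⟨h0.le, by linarith⟩) 0
    left_mem_uIcc).const_add (F 0)
  refine h2.congr_of_eventuallyEq ?_
  filter_upwards [lt_mem_nhds h0] with s hs
  rw [(h s hs).2]
  ring

section Line

variable {E : Type*} [NormedAddCommGroup E] [InnerProductSpace ℝ E]

lemma hasDerivAt_line (y e : E) (t : ℝ) : HasDerivAt (fun s : ℝ => y + s • e) e t := by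
  simpa using ((hasDerivAt_id t).smul_const e).const_add y

lemma isAbsContCurve_line [CompleteSpace E] (y e : E) :
    IsAbsContCurve (Ici 0) (fun s : ℝ => y + s • e) := by
  have hd : deriv (fun s : ℝ => y + s • e) = fun _ => e :=
    funext fun t => (hasDerivAt_line y e t).deriv
  refine ⟨by fun_prop, ae_of_all _ fun t => (hasDerivAt_line y e t).differentiableAt,
    fun t _ => ?_, fun t _ => ?_⟩
  · rw [hd]; exact intervalIntegrable_const
  · rw [hd]; simp

/-- Along a line, the path integrals of `D` with the maximum and with the minimum have the same
derivative, so at almost every point all elements of `D` have the same component along the line,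
namely the directional derivative of the potential. -/
lemma IsPathDifferentiableWith.ae_hasDerivAt_line [CompleteSpace E] {f : E → ℝ} {D : E → Set E}
    (hf : IsPathDifferentiableWith f D) (y e : E) :
    ∀ᵐ t : ℝ, ∀ d ∈ D (y + t • e), HasDerivAt (fun s : ℝ => f (y + s • e)) (inner ℝ e d) t := by
  have hpos : ∀ y : E, ∀ᵐ t : ℝ, 0 < t → ∀ d ∈ D (y + t • e),
      HasDerivAt (fun s : ℝ => f (y + s • e)) (inner ℝ e d) t := by
    intro y
    have hγ := isAbsContCurve_line y e
    have h1 := ae_hasDerivAt_of_integral_eq (F := fun s : ℝ => f (y + s • e))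
      fun T hT => hf.potential.integral_maxRate hγ hT
    have h2 := ae_hasDerivAt_of_integral_eq (F := fun s : ℝ => f (y + s • e))
      fun T hT => hf.potential.integral_minRate hγ hT
    filter_upwards [h1, h2] with t ht1 ht2 ht d hd
    have hc := hf.conservative.isCompact (y + t • e)
    have hle := inner_le_maxRate (γ := fun s : ℝ => y + s • e) hc hd
    have hge := minRate_le_inner (γ := fun s : ℝ => y + s • e) hc hd
    rw [(hasDerivAt_line y e t).deriv] at hle hge
    have heq := (ht1 ht).unique (ht2 ht)
    rw [le_antisymm hle (heq ▸ hge)]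
    exact ht1 ht
  have hshift : ∀ N : ℕ, ∀ᵐ t : ℝ, 0 < t + N → ∀ d ∈ D (y + t • e),
      HasDerivAt (fun s : ℝ => f (y + s • e)) (inner ℝ e d) t := by
    intro N
    have h1 := (measurePreserving_add_right (volume : Measure ℝ) (N : ℝ)).quasiMeasurePreserving.ae
      (hpos (y - (N : ℝ) • e))
    have hpt : ∀ s : ℝ, y - (N : ℝ) • e + (s + N) • e = y + s • e := fun s => by
      rw [add_smul]; abel
    filter_upwards [h1] with t ht h0 d hd
    have h2 := ht h0 d (by rwa [hpt])
    have h3 := h2.comp_add_const t (N : ℝ)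
    simpa only [hpt] using h3
  filter_upwards [ae_all_iff.2 hshift] with t ht
  obtain ⟨N, hN⟩ := exists_nat_gt (-t)
  exact ht N (by linarith)

end Line

/-- A closed-graph mapping that meets a compact set at points arbitrarily close to `x` meets it at
`x`. -/
lemma HasClosedGraph.exists_mem_of_frequently {X Y : Type*} [MetricSpace X] [MetricSpace Y]
    {D : X → Set Y} (hD : HasClosedGraph D) {K : Set Y} (hK : IsCompact K) {x : X}
    (h : ∃ᶠ y in 𝓝 x, ∃ d ∈ D y, d ∈ K) : ∃ d ∈ D x, d ∈ K := by
  obtain ⟨u, hu, hP⟩ := exists_seq_forall_of_frequently h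
  choose d hd hdK using hP
  obtain ⟨a, ha, φ, hφ, hlim⟩ := hK.tendsto_subseq hdK
  refine ⟨a, ?_, ha⟩
  have h1 : Tendsto (fun k => (u (φ k), d (φ k))) atTop (𝓝 (x, a)) :=
    (hu.comp hφ.tendsto_atTop).prodMk_nhds hlim
  exact hD.mem_of_tendsto h1 (Eventually.of_forall fun k => hd (φ k))

/-- If the values are convex and there is a bounded selection near `x`, then the mapping is bounded
near `x`: values reaching far out would contain points on a fixed sphere that `D x` misses. -/
lemma HasClosedGraph.exists_nhds_isBounded_iUnion {X Y : Type*} [MetricSpace X]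
    [NormedAddCommGroup Y] [NormedSpace ℝ Y] [ProperSpace Y] {D : X → Set Y}
    (hD : HasClosedGraph D) (hconv : ∀ x, Convex ℝ (D x)) {x : X}
    (hx : Bornology.IsBounded (D x)) {R : ℝ} (hR : ∀ᶠ y in 𝓝 x, ∃ d ∈ D y, ‖d‖ ≤ R) :
    ∃ V ∈ 𝓝 x, Bornology.IsBounded (⋃ y ∈ V, D y) := by
  obtain ⟨R', hR'⟩ := hx.exists_norm_le
  set r := max R R' + 1
  have hRr : R ≤ r := (le_max_left R R').trans (by simp [r])
  have hRr' : R' < r := (le_max_right R R').trans_lt (by simp [r])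
  refine ⟨{y | ∀ d ∈ D y, ‖d‖ ≤ r}, ?_, ?_⟩
  · by_contra hV
    have hfr : ∃ᶠ y in 𝓝 x, ¬ ∀ d ∈ D y, ‖d‖ ≤ r :=
      not_eventually.1 hV
    obtain ⟨d, hdx, hdr⟩ := hD.exists_mem_of_frequently (isCompact_sphere (0 : Y) r) <|
      (hfr.and_eventually hR).mono fun y hy => by
        obtain ⟨hy1, e, he, hen⟩ := hy
        push Not at hy1
        obtain ⟨d, hd, hdn⟩ := hy1
        obtain ⟨p, hp, hpn⟩ := (hconv y).isPreconnected.intermediate_value he hd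
          continuous_norm.continuousOn ⟨hen.trans hRr, hdn.le⟩
        exact ⟨p, hp, by simpa using hpn⟩
    have h1 := hR' d hdx
    rw [mem_sphere_zero_iff_norm] at hdr
    linarith
  · refine isBounded_iff_forall_norm_le.2 ⟨r, fun d hd => ?_⟩
    obtain ⟨y, hy, hdy⟩ := mem_iUnion₂.1 hd
    exact hy d hdy

lemma HasClosedGraph.measurableSet_lt_abs_inner {E : Type*} [NormedAddCommGroup E]
    [InnerProductSpace ℝ E] [FiniteDimensional ℝ E] [MeasurableSpace E] [BorelSpace E]
    {D : E → Set E} (hD : HasClosedGraph D) (e : E) (C : ℝ) :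
    MeasurableSet {y | ∃ d ∈ D y, C < |inner ℝ e d|} := by
  have : ProperSpace E := FiniteDimensional.proper_real E
  have heq : {y | ∃ d ∈ D y, C < |inner ℝ e d|} = ⋃ k : ℕ, Prod.fst ''
      (({p : E × E | p.2 ∈ D p.1} ∩ {p | C + 1 / ((k : ℝ) + 1) ≤ |inner ℝ e p.2|}) ∩
        Metric.closedBall 0 k) := by
    ext y
    simp only [mem_iUnion, mem_image, mem_inter_iff, Prod.exists, exists_and_right, exists_eq_right]
    constructor
    · rintro ⟨d, hd, hC⟩
      obtain ⟨k, hk⟩ := exists_nat_one_div_lt (sub_pos.2 hC)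
      obtain ⟨m, hm⟩ := exists_nat_ge ‖(y, d)‖
      refine ⟨max k m, d, ⟨hd, ?_⟩, ?_⟩
      · have : 1 / (((max k m : ℕ) : ℝ) + 1) ≤ 1 / ((k : ℝ) + 1) := by
          gcongr; exact le_max_left k m
        change C + _ ≤ _
        linarith
      · rw [mem_closedBall_zero_iff]
        exact hm.trans (by exact_mod_cast le_max_right k m)
    · rintro ⟨k, d, ⟨hd, hC⟩, -⟩
      refine ⟨d, hd, lt_of_lt_of_le ?_ hC⟩
      have : 0 < 1 / ((k : ℝ) + 1) := by positivity
      linarith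
  rw [heq]
  refine MeasurableSet.iUnion fun k => IsCompact.measurableSet (IsCompact.image ?_ continuous_fst)
  refine (isCompact_closedBall _ _).inter_left (IsClosed.inter hD ?_)
  exact isClosed_le (by fun_prop) (by fun_prop)

/-- The bound along almost every point of every line parallel to `e` is a bound at almost every point,
by Fubini. -/
lemma IsPathDifferentiableWith.ae_abs_inner_le {E : Type*} [NormedAddCommGroup E]
    [InnerProductSpace ℝ E] [FiniteDimensional ℝ E] [MeasurableSpace E] [BorelSpace E]
    {f : E → ℝ} {D : E → Set E} (hf : IsPathDifferentiableWith f D) {U : Set E} (hU : IsOpen U)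
    {K : NNReal} (hK : LipschitzOnWith K f U) (e : E) :
    ∀ᵐ y ∂(volume : Measure E), y ∈ U → ∀ d ∈ D y, |inner ℝ e d| ≤ K * ‖e‖ := by
  have : CompleteSpace E := FiniteDimensional.complete ℝ E
  have : ProperSpace E := FiniteDimensional.proper_real E
  have hmeas : MeasurableSet {y | y ∈ U → ∀ d ∈ D y, |inner ℝ e d| ≤ K * ‖e‖} := by
    convert! (hU.measurableSet.inter
      (hf.conservative.closedGraph.measurableSet_lt_abs_inner e (K * ‖e‖))).compl using 1
    ext y
    simp
  refine ae_mem_of_ae_add_linearMap_mem (LinearMap.toSpanSingleton ℝ E e)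
    (volume : Measure ℝ) volume hmeas fun y => ?_
  filter_upwards [hf.ae_hasDerivAt_line y e] with t ht hyt d hd
  rw [LinearMap.toSpanSingleton_apply] at hyt hd
  have hcont : Continuous fun s : ℝ => y + s • e := by fun_prop
  refine (ht d hd).le_of_lip' (by positivity) ?_
  filter_upwards [hcont.continuousAt.preimage_mem_nhds (hU.mem_nhds hyt)] with s hs
  calc ‖f (y + s • e) - f (y + t • e)‖ ≤ K * ‖(y + s • e) - (y + t • e)‖ := hK.norm_sub_le hs hyt
    _ = K * ‖e‖ * ‖s - t‖ := by
      rw [add_sub_add_left_eq_sub, ← sub_smul, norm_smul]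
      ring

lemma _root_.EuclideanSpace.norm_le_card_mul {n : ℕ} {d : EuclideanSpace ℝ (Fin n)} {C : ℝ}
    (h : ∀ i, |d i| ≤ C) : ‖d‖ ≤ n * C := by
  have h1 := (EuclideanSpace.basisFun (Fin n) ℝ).sum_repr d
  calc ‖d‖ = ‖∑ i, (EuclideanSpace.basisFun (Fin n) ℝ).repr d i •
        EuclideanSpace.basisFun (Fin n) ℝ i‖ := by rw [h1]
    _ ≤ ∑ i, ‖(EuclideanSpace.basisFun (Fin n) ℝ).repr d i •
        EuclideanSpace.basisFun (Fin n) ℝ i‖ := norm_sum_le _ _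
    _ ≤ ∑ _i : Fin n, C := Finset.sum_le_sum fun i _ => by simpa [norm_smul] using h i
    _ = n * C := by simp

/-- Local boundedness is not assumed of a conservative field; it follows from the local Lipschitz
continuity of the potential. Convexity of the values cannot be dropped: it prevents a null set of
points from carrying isolated unbounded values. -/
theorem IsPathDifferentiableWith.isLocallyBounded {n : ℕ} {f : EuclideanSpace ℝ (Fin n) → ℝ}
    {D : EuclideanSpace ℝ (Fin n) → Set (EuclideanSpace ℝ (Fin n))}
    (hf : IsPathDifferentiableWith f D) (hconv : ∀ x, Convex ℝ (D x)) : IsLocallyBounded D := by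
  intro x
  obtain ⟨K, V, hV, hK⟩ := hf.locallyLipschitz x
  obtain ⟨U, hUV, hU, hxU⟩ := mem_nhds_iff.1 hV
  have hae : ∀ᵐ y : EuclideanSpace ℝ (Fin n), y ∈ U → ∀ d ∈ D y, ‖d‖ ≤ n * (K : ℝ) := by
    have h1 := fun i : Fin n => hf.ae_abs_inner_le hU (hK.mono hUV)
      (EuclideanSpace.basisFun (Fin n) ℝ i)
    filter_upwards [ae_all_iff.2 h1] with y hy hyU d hd
    refine EuclideanSpace.norm_le_card_mul fun i => ?_
    simpa [EuclideanSpace.inner_single_left] using hy i hyU d hd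
  have hdense := Measure.dense_of_ae hae
  refine hf.conservative.closedGraph.exists_nhds_isBounded_iUnion hconv
    (hf.conservative.isCompact x).isBounded (R := n * (K : ℝ)) ?_
  filter_upwards [hU.mem_nhds hxU] with y hy
  have h2 : ∃ᶠ z in 𝓝 y, ∃ d ∈ D z, d ∈ Metric.closedBall 0 (n * (K : ℝ)) := by
    refine ((mem_closure_iff_frequently.1 (hdense y)).and_eventually (hU.mem_nhds hy)).mono ?_
    rintro z ⟨hz, hzU⟩
    obtain ⟨d, hd⟩ := hf.conservative.nonempty z
    exact ⟨d, hd, by simpa using hz hzU d hd⟩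
  obtain ⟨d, hd, hdn⟩ := hf.conservative.closedGraph.exists_mem_of_frequently
    (isCompact_closedBall _ _) h2
  exact ⟨d, hd, by simpa using hdn⟩

end LocallyBounded

/-! ### The right-hand side of the inclusion and the Lyapunov candidate -/

section Field

variable {n : ℕ}

lemma continuous_rpow_max_add {ε : ℝ} (hε : 0 < ε) :
    Continuous fun v : ℝ => (max v 0 + ε) ^ (-(1 / 2) : ℝ) := by
  refine Continuous.rpow_const (by fun_prop) fun v => Or.inl ?_
  have : 0 ≤ max v 0 := le_max_right _ _
  positivity

lemma continuous_precond {ε : ℝ} (hε : 0 < ε) :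
    Continuous fun p : EuclideanSpace ℝ (Fin n) × EuclideanSpace ℝ (Fin n) =>
      precond ε p.1 p.2 := by
  refine (PiLp.continuous_toLp 2 _).comp (continuous_pi fun i => ?_)
  exact ((continuous_rpow_max_add hε).comp (by fun_prop : Continuous fun
    p : EuclideanSpace ℝ (Fin n) × EuclideanSpace ℝ (Fin n) => p.1 i)).mul (by fun_prop)

lemma isCompact_estimatorSet (n : ℕ) (M : ℝ) : IsCompact (estimatorSet n M) := by
  have h : estimatorSet n M =
      Metric.closedBall 0 M ∩ {d : EuclideanSpace ℝ (Fin n) | ∀ i, 0 ≤ d i} := by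
    ext d
    simp [estimatorSet, and_comm]
  rw [h]
  refine (isCompact_closedBall _ _).inter_right ?_
  rw [ofPred_forall]
  exact isClosed_iInter fun i => isClosed_le (by fun_prop) (by fun_prop)

lemma convex_estimatorSet (n : ℕ) (M : ℝ) : Convex ℝ (estimatorSet n M) := by
  rintro d ⟨hd, hdM⟩ e ⟨he, heM⟩ a b ha hb hab
  refine ⟨fun i => ?_, ?_⟩
  · have := hd i; have := he i
    simp only [PiLp.add_apply, PiLp.smul_apply, smul_eq_mul]
    positivity
  · have := convex_closedBall (0 : EuclideanSpace ℝ (Fin n)) M (by simpa using hdM)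
      (by simpa using heM) ha hb hab
    simpa using this

variable {D : EuclideanSpace ℝ (Fin n) → Set (EuclideanSpace ℝ (Fin n))} {σ ε τ₁ τ₂ M : ℝ}

/-- Membership in the negated field, solved for the subgradient and for the estimator. -/
lemma neg_mem_adamField_iff (hτ₁ : τ₁ ≠ 0) (hτ₂ : τ₂ ≠ 0)
    {z w : EuclideanSpace ℝ (Fin n) × EuclideanSpace ℝ (Fin n) × EuclideanSpace ℝ (Fin n)} :
    -w ∈ adamField D σ ε τ₁ τ₂ M z ↔
      w.1 = -precond ε z.2.2 (z.2.1 + σ • z.1) ∧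
      z.2.1 + τ₁⁻¹ • w.2.1 ∈ D z.1 ∧ z.2.2 + τ₂⁻¹ • w.2.2 ∈ estimatorSet n M := by
  have aux : ∀ {τ : ℝ} (_ : τ ≠ 0) (m d w : EuclideanSpace ℝ (Fin n)),
      -w = τ • m - τ • d ↔ m + τ⁻¹ • w = d := by
    intro τ hτ m d w
    rw [← smul_sub, neg_eq_iff_eq_neg, ← smul_neg, neg_sub, ← inv_smul_eq_iff₀ hτ,
      eq_sub_iff_add_eq']
  simp only [adamField, mem_ofPred_eq, Prod.fst_neg, Prod.snd_neg, aux hτ₁, aux hτ₂,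
    neg_eq_iff_eq_neg]
  simp

/-- The negated field is the image of `D x × U` under a continuous affine map. -/
lemma setOf_neg_mem_adamField (hτ₁ : τ₁ ≠ 0) (hτ₂ : τ₂ ≠ 0)
    (z : EuclideanSpace ℝ (Fin n) × EuclideanSpace ℝ (Fin n) × EuclideanSpace ℝ (Fin n)) :
    {w | -w ∈ adamField D σ ε τ₁ τ₂ M z} =
      {-precond ε z.2.2 (z.2.1 + σ • z.1)} ×ˢ
        ((fun d => τ₁ • d - τ₁ • z.2.1) '' D z.1) ×ˢ
        ((fun u => τ₂ • u - τ₂ • z.2.2) '' estimatorSet n M) := by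
  have aux : ∀ {τ : ℝ} (_ : τ ≠ 0) (m w : EuclideanSpace ℝ (Fin n))
      (S : Set (EuclideanSpace ℝ (Fin n))),
      m + τ⁻¹ • w ∈ S ↔ w ∈ (fun d => τ • d - τ • m) '' S := by
    intro τ hτ m w S
    constructor
    · intro h
      exact ⟨_, h, by simp [smul_smul, hτ]⟩
    · rintro ⟨d, hd, rfl⟩
      simpa [smul_sub, smul_smul, hτ] using hd
  ext w
  simp only [mem_ofPred_eq, neg_mem_adamField_iff hτ₁ hτ₂, mem_prod, mem_singleton_iff, aux hτ₁,
    aux hτ₂]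

lemma isAdmissibleField_neg_adamField (hloc : IsLocallyBounded D) (hgraph : HasClosedGraph D)
    (hne : ∀ x, (D x).Nonempty) (hcomp : ∀ x, IsCompact (D x)) (hconv : ∀ x, Convex ℝ (D x))
    (hε : 0 < ε) (hτ₁ : τ₁ ≠ 0) (hτ₂ : τ₂ ≠ 0) (hM : 0 < M) :
    IsAdmissibleField fun z => {w | -w ∈ adamField D σ ε τ₁ τ₂ M z} where
  nonempty z := by
    rw [setOf_neg_mem_adamField hτ₁ hτ₂]
    refine (singleton_nonempty _).prod (((hne _).image _).prod (Nonempty.image _ ⟨0, ?_⟩))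
    exact ⟨fun i => le_rfl, by simpa using hM.le⟩
  isCompact z := by
    rw [setOf_neg_mem_adamField hτ₁ hτ₂]
    exact isCompact_singleton.prod (((hcomp _).image (by fun_prop)).prod
      ((isCompact_estimatorSet n M).image (by fun_prop)))
  convex z := by
    rw [setOf_neg_mem_adamField hτ₁ hτ₂]
    have aux : ∀ (τ : ℝ) (m : EuclideanSpace ℝ (Fin n)) {S : Set (EuclideanSpace ℝ (Fin n))}
        (_ : Convex ℝ S), Convex ℝ ((fun d => τ • d - τ • m) '' S) := by
      intro τ m S hS
      have h1 := (hS.smul τ).translate (-(τ • m))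
      rw [← image_smul, image_image] at h1
      simpa only [neg_add_eq_sub] using h1
    exact (convex_singleton _).prod ((aux τ₁ _ (hconv _)).prod (aux τ₂ _ (convex_estimatorSet n M)))
  closedGraph := by
    simp only [HasClosedGraph, mem_ofPred_eq, neg_mem_adamField_iff hτ₁ hτ₂]
    refine IsClosed.inter ?_ (IsClosed.inter ?_ ?_)
    · refine isClosed_eq (by fun_prop) (Continuous.neg ?_)
      exact (continuous_precond hε).comp (by fun_prop : Continuous fun p :
        (EuclideanSpace ℝ (Fin n) × EuclideanSpace ℝ (Fin n) × EuclideanSpace ℝ (Fin n)) ×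
        (EuclideanSpace ℝ (Fin n) × EuclideanSpace ℝ (Fin n) × EuclideanSpace ℝ (Fin n)) =>
          (p.1.2.2, p.1.2.1 + σ • p.1.1))
    · exact IsClosed.preimage (by fun_prop : Continuous fun p :
        (EuclideanSpace ℝ (Fin n) × EuclideanSpace ℝ (Fin n) × EuclideanSpace ℝ (Fin n)) ×
        (EuclideanSpace ℝ (Fin n) × EuclideanSpace ℝ (Fin n) × EuclideanSpace ℝ (Fin n)) =>
          (p.1.1, p.1.2.1 + τ₁⁻¹ • p.2.2.1)) hgraph
    · exact IsClosed.preimage (by fun_prop) (isCompact_estimatorSet n M).isClosed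
  locallyBounded z := by
    obtain ⟨V, hV, hVb⟩ := hloc z.1
    have hVx : ∀ᶠ y : EuclideanSpace ℝ (Fin n) × EuclideanSpace ℝ (Fin n) ×
        EuclideanSpace ℝ (Fin n) in 𝓝 z, y.1 ∈ V := continuous_fst.continuousAt hV
    have hball := Metric.closedBall_mem_nhds z one_pos
    refine ⟨Metric.closedBall z 1 ∩ {y | y.1 ∈ V}, inter_mem hball hVx, ?_⟩
    have hK : IsCompact (closure (⋃ y ∈ V, D y)) := hVb.isCompact_closure
    -- the field over this neighbourhood is contained in a continuous image of a compact set
    have himg := ((isCompact_closedBall z (1 : ℝ)).prod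
      (hK.prod (isCompact_estimatorSet n M))).image
      (f := fun q : (EuclideanSpace ℝ (Fin n) × EuclideanSpace ℝ (Fin n) ×
          EuclideanSpace ℝ (Fin n)) × EuclideanSpace ℝ (Fin n) × EuclideanSpace ℝ (Fin n) =>
        (-precond ε q.1.2.2 (q.1.2.1 + σ • q.1.1), τ₁ • q.2.1 - τ₁ • q.1.2.1,
          τ₂ • q.2.2 - τ₂ • q.1.2.2)) <| by
        refine Continuous.prodMk (Continuous.neg ?_) (by fun_prop)
        exact (continuous_precond hε).comp (by fun_prop : Continuous fun q :
          (EuclideanSpace ℝ (Fin n) × EuclideanSpace ℝ (Fin n) × EuclideanSpace ℝ (Fin n)) ×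
          EuclideanSpace ℝ (Fin n) × EuclideanSpace ℝ (Fin n) =>
            (q.1.2.2, q.1.2.1 + σ • q.1.1))
    refine himg.isBounded.subset (iUnion₂_subset fun y hy => ?_)
    beta_reduce
    rw [setOf_neg_mem_adamField hτ₁ hτ₂]
    rintro ⟨w₁, w₂, w₃⟩ ⟨rfl, ⟨d, hd, rfl⟩, ⟨u, hu, rfl⟩⟩
    exact ⟨(y, d, u), ⟨hy.1, subset_closure (mem_biUnion hy.2 hd), hu⟩, rfl⟩

lemma isClosed_stableSet (hgraph : HasClosedGraph D) :
    IsClosed {z : EuclideanSpace ℝ (Fin n) × EuclideanSpace ℝ (Fin n) × EuclideanSpace ℝ (Fin n) |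
      0 ∈ regField D σ z.1 ∧ z.2.1 + σ • z.1 = 0} := by
  have h : ∀ x, 0 ∈ regField D σ x ↔ -(σ • x) ∈ D x := fun x => by
    simp [regField]
  simp only [h]
  refine IsClosed.inter ?_ (isClosed_eq (by fun_prop) (by fun_prop))
  exact IsClosed.preimage (by fun_prop : Continuous fun z : EuclideanSpace ℝ (Fin n) ×
    EuclideanSpace ℝ (Fin n) × EuclideanSpace ℝ (Fin n) => (z.1, -(σ • z.1))) hgraph

lemma continuous_adamLyapunov {f : EuclideanSpace ℝ (Fin n) → ℝ} (hf : Continuous f)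
    (hε : 0 < ε) : Continuous (adamLyapunov f σ ε τ₁) := by
  have h1 : Continuous fun z : EuclideanSpace ℝ (Fin n) × EuclideanSpace ℝ (Fin n) ×
      EuclideanSpace ℝ (Fin n) => precond ε z.2.2 (z.2.1 + σ • z.1) :=
    (continuous_precond hε).comp (by fun_prop : Continuous fun z : EuclideanSpace ℝ (Fin n) ×
      EuclideanSpace ℝ (Fin n) × EuclideanSpace ℝ (Fin n) => (z.2.2, z.2.1 + σ • z.1))
  unfold adamLyapunov
  fun_prop

end Field

/-! ### Dissipation in one coordinate -/

section Scalar

variable {ε : ℝ}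

lemma rpow_max_add_pos (hε : 0 < ε) (v : ℝ) : 0 < (max v 0 + ε) ^ (-(1 / 2) : ℝ) :=
  Real.rpow_pos_of_pos (add_pos_of_nonneg_of_pos (le_max_right _ _) hε) _

lemma rpow_max_add_le (hε : 0 < ε) (v : ℝ) :
    (max v 0 + ε) ^ (-(1 / 2) : ℝ) ≤ ε ^ (-(1 / 2) : ℝ) :=
  Real.rpow_le_rpow_of_nonpos hε (by linarith [le_max_right v 0]) (by norm_num)

lemma exists_lipschitzWith_rpow_max_add (hε : 0 < ε) :
    ∃ K, LipschitzWith K fun v : ℝ => (max v 0 + ε) ^ (-(1 / 2) : ℝ) := by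
  have hC : 0 ≤ 1 / 2 * ε ^ (-(1 / 2) - 1 : ℝ) := by positivity
  refine ⟨⟨_, hC⟩, LipschitzWith.of_dist_le_mul fun a b => ?_⟩
  have hderiv : ∀ s ∈ Ici (0 : ℝ), HasDerivWithinAt (fun s : ℝ => (s + ε) ^ (-(1 / 2) : ℝ))
      (1 * (-(1 / 2)) * (s + ε) ^ (-(1 / 2) - 1 : ℝ)) (Ici 0) s := fun s hs =>
    (((hasDerivAt_id s).add_const ε).rpow_const
      (Or.inl (add_pos_of_nonneg_of_pos hs hε).ne')).hasDerivWithinAt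
  have hbound : ∀ s ∈ Ici (0 : ℝ),
      ‖1 * (-(1 / 2)) * (s + ε) ^ (-(1 / 2) - 1 : ℝ)‖ ≤ 1 / 2 * ε ^ (-(1 / 2) - 1 : ℝ) := by
    intro s hs
    have hs' : 0 ≤ s := hs
    have h1 : (s + ε) ^ (-(1 / 2) - 1 : ℝ) ≤ ε ^ (-(1 / 2) - 1 : ℝ) :=
      Real.rpow_le_rpow_of_nonpos hε (by linarith) (by norm_num)
    have h2 : 0 ≤ (s + ε) ^ (-(1 / 2) - 1 : ℝ) := by positivity
    rw [norm_mul, Real.norm_of_nonneg h2]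
    norm_num at h1 ⊢
    linarith
  have h1 := (convex_Ici (0 : ℝ)).norm_image_sub_le_of_norm_hasDerivWithin_le hderiv hbound
    (le_max_right b 0) (le_max_right a 0)
  rw [dist_eq_norm, dist_eq_norm]
  refine h1.trans (mul_le_mul_of_nonneg_left ?_ hC)
  simpa using abs_max_sub_max_le_abs a b 0

/-- If `v' ≥ -τ v`, then the preconditioner grows at relative rate at most `τ / 2`. Where `v ≤ 0`
the preconditioner is at its maximum, so its derivative, if there is one, vanishes. -/
lemma deriv_rpow_max_add_le (hε : 0 < ε) {τ : ℝ} (hτ : 0 ≤ τ) {v : ℝ → ℝ} {t : ℝ}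
    (hv : DifferentiableAt ℝ v t) (hd : -(τ * v t) ≤ deriv v t) :
    deriv (fun s => (max (v s) 0 + ε) ^ (-(1 / 2) : ℝ)) t ≤
      τ / 2 * (max (v t) 0 + ε) ^ (-(1 / 2) : ℝ) := by
  rcases le_or_gt (v t) 0 with h0 | h0
  · have hmax : IsLocalMax (fun s => (max (v s) 0 + ε) ^ (-(1 / 2) : ℝ)) t :=
      Eventually.of_forall fun s => by
        simpa only [max_eq_right h0, zero_add] using rpow_max_add_le hε (v s)
    rw [hmax.deriv_eq_zero]
    have := rpow_max_add_pos hε (v t)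
    positivity
  · have hpos : 0 < v t + ε := by linarith
    have heq : (fun s => (max (v s) 0 + ε) ^ (-(1 / 2) : ℝ)) =ᶠ[𝓝 t]
        fun s => (v s + ε) ^ (-(1 / 2) : ℝ) := by
      filter_upwards [hv.continuousAt (lt_mem_nhds h0)] with s hs
      rw [max_eq_left (le_of_lt hs)]
    have h1 : HasDerivAt (fun s => (v s + ε) ^ (-(1 / 2) : ℝ)) _ t :=
      (hv.hasDerivAt.add_const ε).rpow_const (Or.inl hpos.ne')
    rw [heq.deriv_eq, h1.deriv, max_eq_left h0.le]
    have h2 : (v t + ε) ^ (-(1 / 2) : ℝ) = (v t + ε) ^ (-(1 / 2) - 1 : ℝ) * (v t + ε) := by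
      rw [← Real.rpow_add_one hpos.ne']
      norm_num
    have h3 : 0 < (v t + ε) ^ (-(1 / 2) - 1 : ℝ) := Real.rpow_pos_of_pos hpos _
    rw [h2]
    have h4 : -deriv v t / 2 ≤ τ / 2 * (v t + ε) := by nlinarith [mul_nonneg hτ hε.le]
    nlinarith [mul_le_mul_of_nonneg_right h4 h3.le]

/-- The contribution of one coordinate to the Lyapunov function, apart from `f`. -/
noncomputable def coordEnergy (σ ε τ₁ x m v : ℝ) : ℝ :=
  σ / 2 * x ^ 2 + 1 / (2 * τ₁) * ((max v 0 + ε) ^ (-(1 / 2) : ℝ) * (m + σ * x) ^ 2)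

variable {σ τ₁ τ₂ : ℝ} {x m v : ℝ → ℝ}

lemma absolutelyContinuousOnInterval_coordEnergy (hε : 0 < ε) {a b : ℝ}
    (hx : AbsolutelyContinuousOnInterval x a b) (hm : AbsolutelyContinuousOnInterval m a b)
    (hv : AbsolutelyContinuousOnInterval v a b) :
    AbsolutelyContinuousOnInterval (fun t => coordEnergy σ ε τ₁ (x t) (m t) (v t)) a b := by
  obtain ⟨K, hK⟩ := exists_lipschitzWith_rpow_max_add hε
  have hw := hK.comp_absolutelyContinuousOnInterval hv
  have hy := hm.fun_add (hx.const_mul σ)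
  simp only [coordEnergy, pow_two]
  exact ((hx.fun_mul hx).const_mul _).fun_add ((hw.fun_mul (hy.fun_mul hy)).const_mul _)

/-- Dissipation in one coordinate. With `w` the preconditioner, `y = m + σ x` and
`d = m + m' / τ₁`, the derivative of the energy is
`-d x' - (σ / τ₁) x'² - w y² + w' y² / (2 τ₁)`, and the last term is absorbed by `w y²` because
`w' ≤ (τ₂ / 2) w` and `τ₂ ≤ 4 τ₁`. -/
lemma deriv_coordEnergy_le (hε : 0 < ε) (hτ₂ : 0 < τ₂) (hτ₁ : τ₂ / 4 ≤ τ₁) {t : ℝ}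
    (hx : DifferentiableAt ℝ x t) (hm : DifferentiableAt ℝ m t) (hv : DifferentiableAt ℝ v t)
    (hw : DifferentiableAt ℝ (fun s => (max (v s) 0 + ε) ^ (-(1 / 2) : ℝ)) t)
    (hx' : deriv x t = -((max (v t) 0 + ε) ^ (-(1 / 2) : ℝ) * (m t + σ * x t)))
    (hv' : -(τ₂ * v t) ≤ deriv v t) :
    deriv (fun s => coordEnergy σ ε τ₁ (x s) (m s) (v s)) t ≤
      -(σ / τ₁) * ((max (v t) 0 + ε) ^ (-(1 / 2) : ℝ) * (m t + σ * x t)) ^ 2 -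
        (m t + τ₁⁻¹ * deriv m t) * deriv x t := by
  have hτ : 0 < τ₁ := by linarith
  have hw' := deriv_rpow_max_add_le hε hτ₂.le hv hv'
  have hwpos := rpow_max_add_pos hε (v t)
  have h1 : HasDerivAt (fun s => coordEnergy σ ε τ₁ (x s) (m s) (v s)) _ t :=
    ((hx.hasDerivAt.pow 2).const_mul (σ / 2)).add ((hw.hasDerivAt.mul
      ((hm.hasDerivAt.add (hx.hasDerivAt.const_mul σ)).pow 2)).const_mul (1 / (2 * τ₁)))
  rw [h1.deriv]
  simp only [Pi.add_apply, Pi.pow_apply]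
  set w := (max (v t) 0 + ε) ^ (-(1 / 2) : ℝ)
  set w' := deriv (fun s => (max (v s) 0 + ε) ^ (-(1 / 2) : ℝ)) t
  rw [hx']
  set y := m t + σ * x t with hy
  have h2 : w' / (2 * τ₁) ≤ w := by
    rw [div_le_iff₀ (by positivity)]
    nlinarith
  have h3 : w' / (2 * τ₁) * y ^ 2 ≤ w * y ^ 2 := mul_le_mul_of_nonneg_right h2 (sq_nonneg y)
  have hmy : m t = y - σ * x t := by rw [hy]; ring
  rw [hmy]
  rw [← sub_nonneg] at h3 ⊢
  refine h3.trans_eq ?_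
  field_simp
  ring

end Scalar

/-! ### Energy inequality along solutions -/

section Energy

variable {n : ℕ} {f : EuclideanSpace ℝ (Fin n) → ℝ}
  {D : EuclideanSpace ℝ (Fin n) → Set (EuclideanSpace ℝ (Fin n))} {σ ε τ₁ τ₂ M : ℝ}

lemma precond_apply (v w : EuclideanSpace ℝ (Fin n)) (i : Fin n) :
    precond ε v w i = (max (v i) 0 + ε) ^ (-(1 / 2) : ℝ) * w i := rfl

lemma precond_eq_zero_iff (hε : 0 < ε) (v w : EuclideanSpace ℝ (Fin n)) :
    precond ε v w = 0 ↔ w = 0 := by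
  constructor
  · intro h
    ext i
    have h1 := congrArg (fun u : EuclideanSpace ℝ (Fin n) => u i) h
    simp only [precond_apply, PiLp.zero_apply] at h1
    simpa using (mul_eq_zero.1 h1).resolve_left (rpow_max_add_pos hε _).ne'
  · rintro rfl
    ext i
    simp [precond_apply]

lemma continuous_dissipation (hε : 0 < ε) : Continuous fun z : EuclideanSpace ℝ (Fin n) ×
    EuclideanSpace ℝ (Fin n) × EuclideanSpace ℝ (Fin n) =>
      σ / τ₁ * ‖precond ε z.2.2 (z.2.1 + σ • z.1)‖ ^ 2 := by
  have := (continuous_precond (n := n) hε).comp (by fun_prop : Continuous fun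
    z : EuclideanSpace ℝ (Fin n) × EuclideanSpace ℝ (Fin n) × EuclideanSpace ℝ (Fin n) =>
      (z.2.2, z.2.1 + σ • z.1))
  exact continuous_const.mul (this.norm.pow 2)

lemma adamLyapunov_eq_add_sum
    (z : EuclideanSpace ℝ (Fin n) × EuclideanSpace ℝ (Fin n) × EuclideanSpace ℝ (Fin n)) :
    adamLyapunov f σ ε τ₁ z = f z.1 + ∑ i, coordEnergy σ ε τ₁ (z.1 i) (z.2.1 i) (z.2.2 i) := by
  simp only [adamLyapunov, coordEnergy, Finset.sum_add_distrib, ← Finset.mul_sum,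
    EuclideanSpace.real_norm_sq_eq, PiLp.inner_apply, precond_apply, PiLp.add_apply,
    PiLp.smul_apply, smul_eq_mul, RCLike.inner_apply, conj_trivial, add_assoc]
  congr 4
  ext i
  ring

variable {γ : ℝ → EuclideanSpace ℝ (Fin n) × EuclideanSpace ℝ (Fin n) × EuclideanSpace ℝ (Fin n)}

/-- Along a solution the Lyapunov function decreases at least at the rate
`(σ / τ₁) ‖x'‖²`. The element `d = m + m' / τ₁` of `D x` selected by the solution need not realise
the minimum in the path integral for `f`, but `⟪x', d⟫` bounds it from above, and this bound cancels
against the energy of the momentum. -/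
theorem IsSolution.adamLyapunov_sub_le (hpot : IsPotential D f) (hcomp : ∀ x, IsCompact (D x))
    (hε : 0 < ε) (hτ₂ : 0 < τ₂) (hτ₁ : τ₂ / 4 ≤ τ₁)
    (hγ : IsSolution (fun z => {w | -w ∈ adamField D σ ε τ₁ τ₂ M z}) γ) {T : ℝ} (hT : 0 < T) :
    adamLyapunov f σ ε τ₁ (γ T) - adamLyapunov f σ ε τ₁ (γ 0) ≤
      -∫ t in (0 : ℝ)..T, σ / τ₁ * ‖precond ε (γ t).2.2 ((γ t).2.1 + σ • (γ t).1)‖ ^ 2 := by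
  have hτ : 0 < τ₁ := by linarith
  let E := EuclideanSpace ℝ (Fin n)
  let Lx : E × E × E →L[ℝ] E := ContinuousLinearMap.fst ℝ E (E × E)
  let Lm : E × E × E →L[ℝ] E :=
    (ContinuousLinearMap.fst ℝ E E).comp (ContinuousLinearMap.snd ℝ E (E × E))
  let Lv : E × E × E →L[ℝ] E :=
    (ContinuousLinearMap.snd ℝ E E).comp (ContinuousLinearMap.snd ℝ E (E × E))
  have hac := hγ.absCont
  let S : Fin n → ℝ → ℝ := fun i t => coordEnergy σ ε τ₁ ((γ t).1 i) ((γ t).2.1 i) ((γ t).2.2 i)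
  have hacx := fun i => hac.clm_comp ((EuclideanSpace.proj i : E →L[ℝ] ℝ).comp Lx)
  have hacm := fun i => hac.clm_comp ((EuclideanSpace.proj i : E →L[ℝ] ℝ).comp Lm)
  have hacv := fun i => hac.clm_comp ((EuclideanSpace.proj i : E →L[ℝ] ℝ).comp Lv)
  have hS : ∀ i, AbsolutelyContinuousOnInterval (S i) 0 T := fun i =>
    absolutelyContinuousOnInterval_coordEnergy hε
      ((hacx i).absolutelyContinuousOnInterval hT.le)
      ((hacm i).absolutelyContinuousOnInterval hT.le)
      ((hacv i).absolutelyContinuousOnInterval hT.le)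
  obtain ⟨K, hK⟩ := exists_lipschitzWith_rpow_max_add hε
  have hw := fun i => (hK.comp_absolutelyContinuousOnInterval
    ((hacv i).absolutelyContinuousOnInterval hT.le)).ae_differentiableAt
  have hxc : IsAbsContCurve (Ici 0) (fun t => (γ t).1) := hac.clm_comp Lx
  obtain ⟨hfi, hfe⟩ := hpot.integral_minRate hxc hT
  have hSint : IntervalIntegrable (fun t => ∑ i, deriv (S i) t) volume 0 T := by
    have h1 := IntervalIntegrable.sum Finset.univ
      fun i (_ : i ∈ Finset.univ) => (hS i).intervalIntegrable_deriv
    exact h1.congr fun t _ => Finset.sum_apply t _ _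
  have hincr : adamLyapunov f σ ε τ₁ (γ T) - adamLyapunov f σ ε τ₁ (γ 0) =
      ∫ t in (0 : ℝ)..T, (minRate D (fun t => (γ t).1) t + ∑ i, deriv (S i) t) := by
    rw [intervalIntegral.integral_add hfi hSint,
      intervalIntegral.integral_finsetSum fun i _ => (hS i).intervalIntegrable_deriv, hfe]
    simp only [fun i => (hS i).integral_deriv_eq_sub, Finset.sum_sub_distrib,
      adamLyapunov_eq_add_sum, S]
    ring
  have hcont : ContinuousOn
      (fun t => σ / τ₁ * ‖precond ε (γ t).2.2 ((γ t).2.1 + σ • (γ t).1)‖ ^ 2) (uIcc 0 T) := by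
    refine (continuous_dissipation hε).comp_continuousOn (hac.continuousOn.mono ?_)
    rw [uIcc_of_le hT.le]
    exact Icc_subset_Ici_self
  rw [hincr, ← intervalIntegral.integral_neg]
  refine intervalIntegral.integral_mono_ae_restrict hT.le
    (hfi.add hSint)
    hcont.intervalIntegrable.neg ?_
  rw [EventuallyLE, ae_restrict_iff' measurableSet_Icc]
  have h1 := hac.ae_differentiableAt
  have h2 := hγ.ae_mem
  rw [ae_restrict_iff' measurableSet_Ici] at h1 h2
  filter_upwards [h1, h2, ae_all_iff.2 hw] with t ht1 ht2 ht3 ht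
  have hd := ht1 ht.1
  obtain ⟨hx', hm', hv'⟩ := (neg_mem_adamField_iff hτ.ne' hτ₂.ne').1 (ht2 ht.1)
  have hLx : HasDerivAt (fun s => (γ s).1) (deriv γ t).1 t :=
    Lx.hasFDerivAt.comp_hasDerivAt t hd.hasDerivAt
  have hxi : ∀ i, HasDerivAt (fun s => (γ s).1 i) ((deriv γ t).1 i) t := fun i =>
    ((EuclideanSpace.proj i : E →L[ℝ] ℝ).comp Lx).hasFDerivAt.comp_hasDerivAt t hd.hasDerivAt
  have hmi : ∀ i, HasDerivAt (fun s => (γ s).2.1 i) ((deriv γ t).2.1 i) t := fun i =>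
    ((EuclideanSpace.proj i : E →L[ℝ] ℝ).comp Lm).hasFDerivAt.comp_hasDerivAt t hd.hasDerivAt
  have hvi : ∀ i, HasDerivAt (fun s => (γ s).2.2 i) ((deriv γ t).2.2 i) t := fun i =>
    ((EuclideanSpace.proj i : E →L[ℝ] ℝ).comp Lv).hasFDerivAt.comp_hasDerivAt t hd.hasDerivAt
  have hmin := minRate_le_inner (γ := fun s => (γ s).1) (t := t) (hcomp _) hm'
  have hSi : ∀ i, deriv (S i) t ≤
      -(σ / τ₁) * (precond ε (γ t).2.2 ((γ t).2.1 + σ • (γ t).1) i) ^ 2 -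
        ((γ t).2.1 + τ₁⁻¹ • (deriv γ t).2.1) i * (deriv γ t).1 i := by
    intro i
    have h3 := deriv_coordEnergy_le (σ := σ) hε hτ₂ hτ₁ (hxi i).differentiableAt
      (hmi i).differentiableAt (hvi i).differentiableAt
      (ht3 i (by rwa [uIcc_of_le hT.le])) (by rw [(hxi i).deriv, hx']; rfl) (by
        rw [(hvi i).deriv]
        have h4 := hv'.1 i
        simp only [PiLp.add_apply, PiLp.smul_apply, smul_eq_mul] at h4
        have h5 := mul_nonneg hτ₂.le h4
        rw [mul_add, mul_inv_cancel_left₀ hτ₂.ne'] at h5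
        linarith)
    rw [(hxi i).deriv, (hmi i).deriv] at h3
    exact h3
  rw [hLx.deriv, PiLp.inner_apply] at hmin
  simp only [RCLike.inner_apply, conj_trivial] at hmin
  have hsum := Finset.sum_le_sum fun i (_ : i ∈ Finset.univ) => hSi i
  rw [Finset.sum_sub_distrib, ← Finset.mul_sum, ← EuclideanSpace.real_norm_sq_eq] at hsum
  linarith

/-- If `m + σ x` vanishes on `[0, T]`, then `x` is constant there and hence so is `m`, which forces
`-σ x ∈ D x`. -/
lemma IsSolution.zero_mem_regField (hε : 0 < ε) (hτ₁ : τ₁ ≠ 0) (hτ₂ : τ₂ ≠ 0)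
    (hγ : IsSolution (fun z => {w | -w ∈ adamField D σ ε τ₁ τ₂ M z}) γ) {T : ℝ} (hT : 0 < T)
    (h : ∀ t ∈ Icc 0 T, (γ t).2.1 + σ • (γ t).1 = 0) : 0 ∈ regField D σ (γ 0).1 := by
  let E := EuclideanSpace ℝ (Fin n)
  let Lx : E × E × E →L[ℝ] E := ContinuousLinearMap.fst ℝ E (E × E)
  let Ly : E × E × E →L[ℝ] E :=
    (ContinuousLinearMap.fst ℝ E E).comp (ContinuousLinearMap.snd ℝ E (E × E)) + σ • Lx
  have hac := hγ.absCont
  have hxc : IsAbsContCurve (Ici 0) (fun t => (γ t).1) := hac.clm_comp Lx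
  have h1 := hac.ae_differentiableAt
  have h2 := hγ.ae_mem
  rw [ae_restrict_iff' measurableSet_Ici] at h1 h2
  have hx0 : ∀ᵐ t, t ∈ Icc 0 T → (deriv γ t).1 = 0 := by
    filter_upwards [h2] with t ht2 ht
    rw [((neg_mem_adamField_iff hτ₁ hτ₂).1 (ht2 ht.1)).1, h t ht, neg_eq_zero,
      precond_eq_zero_iff hε]
  have hconst : ∀ t ∈ Icc 0 T, (γ t).1 = (γ 0).1 := by
    intro t ht
    have h3 : ∫ s in (0 : ℝ)..t, deriv (fun s => (γ s).1) s = ∫ s in (0 : ℝ)..t, (0 : E) := by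
      refine intervalIntegral.integral_congr_ae ?_
      filter_upwards [hx0, h1] with s hs hs1 hm
      rw [uIoc_of_le ht.1] at hm
      rw [← hs ⟨hm.1.le, hm.2.trans ht.2⟩]
      exact (Lx.hasFDerivAt.comp_hasDerivAt s (hs1 hm.1.le).hasDerivAt).deriv
    have h4 := hxc.eq_integral t ht.1
    rw [h3] at h4
    simpa using h4
  have hne : (ae (volume.restrict (Ioo 0 T))).NeBot := by
    rw [ae_neBot, Ne, Measure.restrict_eq_zero, Real.volume_Ioo]
    simpa using hT
  have hex : ∀ᵐ t ∂(volume.restrict (Ioo 0 T)), t ∈ Ioo 0 T ∧ DifferentiableAt ℝ γ t ∧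
      -deriv γ t ∈ adamField D σ ε τ₁ τ₂ M (γ t) ∧ (deriv γ t).1 = 0 := by
    rw [ae_restrict_iff' measurableSet_Ioo]
    filter_upwards [h1, h2, hx0] with t ht1 ht2 ht3 ht
    exact ⟨ht, ht1 ht.1.le, ht2 ht.1.le, ht3 ⟨ht.1.le, ht.2.le⟩⟩
  obtain ⟨t, ht, hd, hmem, hxt⟩ := hex.exists
  have hy : HasDerivAt (fun s => (γ s).2.1 + σ • (γ s).1)
      ((deriv γ t).2.1 + σ • (deriv γ t).1) t := Ly.hasFDerivAt.comp_hasDerivAt t hd.hasDerivAt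
  have hy0 : (fun s => (γ s).2.1 + σ • (γ s).1) =ᶠ[𝓝 t] fun _ => (0 : E) := by
    filter_upwards [Ioo_mem_nhds ht.1 ht.2] with s hs using h s ⟨hs.1.le, hs.2.le⟩
  have hm' := hy.unique ((hasDerivAt_const t (0 : E)).congr_of_eventuallyEq hy0)
  rw [hxt, smul_zero, add_zero] at hm'
  have htI : t ∈ Icc 0 T := ⟨ht.1.le, ht.2.le⟩
  have hD := ((neg_mem_adamField_iff hτ₁ hτ₂).1 hmem).2.1
  rw [hm', smul_zero, add_zero, hconst t htI] at hD
  refine ⟨_, hD, ?_⟩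
  have := h t htI
  rwa [hconst t htI] at this

end Energy

end AdamLyapunov

theorem mainTheorem8 (n : ℕ)
    (f : EuclideanSpace ℝ (Fin n) → ℝ)
    (D : EuclideanSpace ℝ (Fin n) → Set (EuclideanSpace ℝ (Fin n)))
    (hf : AdamLyapunov.IsPathDifferentiableWith f D)
    (hconv : ∀ x, Convex ℝ (D x))
    (σ ε τ₁ τ₂ M : ℝ) (hσ : 0 < σ) (hε : 0 < ε) (hτ₂ : 0 < τ₂) (hτ₁ : τ₂ / 4 ≤ τ₁)
    (hM : 0 < M) :
    AdamLyapunov.IsLyapunovFunction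
      (fun z => {w | -w ∈ AdamLyapunov.adamField D σ ε τ₁ τ₂ M z})
      (AdamLyapunov.adamLyapunov f σ ε τ₁)
      {z | 0 ∈ AdamLyapunov.regField D σ z.1 ∧ z.2.1 + σ • z.1 = 0} := by
  have hτ : 0 < τ₁ := by linarith
  have hc := hf.conservative
  refine ⟨AdamLyapunov.isAdmissibleField_neg_adamField (hf.isLocallyBounded hconv) hc.closedGraph
      hc.nonempty hc.isCompact hconv hε hτ.ne' hτ₂.ne' hM,
    AdamLyapunov.isClosed_stableSet hc.closedGraph,
    AdamLyapunov.continuous_adamLyapunov hf.locallyLipschitz.continuous hε, ?_, ?_⟩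
  · intro γ hγ _ T hT
    rcases hT.eq_or_lt with rfl | hT
    · exact le_rfl
    have h1 := hγ.adamLyapunov_sub_le hf.potential hc.isCompact hε hτ₂ hτ₁ hT
    have h2 : 0 ≤ ∫ t in (0 : ℝ)..T, σ / τ₁ *
        ‖AdamLyapunov.precond ε (γ t).2.2 ((γ t).2.1 + σ • (γ t).1)‖ ^ 2 :=
      intervalIntegral.integral_nonneg hT.le fun t _ => by positivity
    linarith
  · intro γ hγ h0 T hT
    have h1 := hγ.adamLyapunov_sub_le hf.potential hc.isCompact hε hτ₂ hτ₁ hT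
    have hex : ∃ c ∈ Icc 0 T, (γ c).2.1 + σ • (γ c).1 ≠ 0 := by
      by_contra! hy
      exact h0 ⟨hγ.zero_mem_regField hε hτ.ne' hτ₂.ne' hT hy, hy 0 ⟨le_rfl, hT.le⟩⟩
    obtain ⟨c, hcT, hc0⟩ := hex
    have h2 : 0 < ∫ t in (0 : ℝ)..T, σ / τ₁ *
        ‖AdamLyapunov.precond ε (γ t).2.2 ((γ t).2.1 + σ • (γ t).1)‖ ^ 2 := by
      refine intervalIntegral.integral_pos hT ?_ (fun t _ => by positivity) ⟨c, hcT, ?_⟩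
      · exact (AdamLyapunov.continuous_dissipation hε).comp_continuousOn
          (hγ.absCont.continuousOn.mono Icc_subset_Ici_self)
      · have := norm_pos_iff.2 (mt (AdamLyapunov.precond_eq_zero_iff hε (γ c).2.2 _).1 hc0)
        positivity
    linarith
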